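/- Let $D,T\ge 1$ and consider $T$ binary classification tasks; task $m$ has a nonempty finite dataset $S_m$ of $N_m$ samples $(x,y)\in\mathbb{R}^D\times\{-1,+1\}$, with feasible set $\mathcal{W}_m=\{w\in\mathbb{R}^D : y\,w^\top x\ge 1\ \ \forall (x,y)\in S_m\}$. Call the collection $(S_1,\dots,S_T)$ separable if every $\mathcal{W}_m$ is nonempty (the tasks need not be jointly separable). Let $\tau(1),\tau(2),\ldots\in\{1,\dots,T\}$ be any sequence of tasks, repetitions allowed. The *Sequential Max-Margin* iterates are $w_0=0$ and $$w_t=\operatorname*{argmin}_{w\in\mathcal{W}_{\tau(t)}}\|w-w_{t-1}\|^2 ,$$ and, for $\lambda>0$, the *regularized continual learning* iterates (constant strength $\lambda$, unweighted Euclidean penalty) are $w_0^{(\lambda)}=0$ and $$w_t^{(\lambda)}=\operatorname*{argmin}_{w\in\mathbb{R}^D}\ \sum_{(x,y)\in S_{\tau(t)}}e^{-y\,w^\top x}+\frac{\lambda}{2}\,\|w-w_{t-1}^{(\lambda)}\|^2 .$$ **Theorem.** For almost all separable collections of datasets (that is, with probability one on the event of separability when the collection is sampled from any law which is absolutely continuous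 with respect to the product of Lebesgue measures on the feature vectors and counting measures on the labels), both sequences are well defined and unique, and: 1. There are a constant $C$ and a $\lambda_0>0$ (depending on the datasets and on $\tau$, but not on $t$ or $\lambda$) such that for all $0<\lambda<\lambda_0$ and all $t\ge 0$ $$\bigl\|w_t^{(\lambda)}-\ln(1/\lambda)\,w_t\bigr\|\le C\,t\,\ln\ln(1/\lambda).$$ 2. For every $t\ge 1$ one has $w_t\ne 0$ and $$\lim_{\lambda\to 0^+}\frac{w_t^{(\lambda)}}{\|w_t^{(\lambda)}\|}=\frac{w_t}{\|w_t\|}.$$ More generally, if $t=t(\lambda)\ge 1$ may vary with $\lambda$ and $t(\lambda)=o\!\left(\frac{\ln(1/\lambda)}{\ln\ln(1/\lambda)}\right)$ as $\lambda\to 0^+$, then $w_{t(\lambda)}^{(\lambda)}\ne 0$ for all small enough $\lambda$ and $$\frac{w_{t(\lambda)}^{(\lambda)}}{\|w_{t(\lambda)}^{(\lambda)}\|}-\frac{w_{t(\lambda)}}{\|w_{t(\lambda)}\|}\ \longrightarrow\ 0\qquad(\lambda\to 0^+).$$ -/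

import Mathlib

open Filter Topology Asymptotics MeasureTheory

noncomputable section

/-- Singletons of labels are measurable, so that counting measure on labels is the usual one and
the reference measure on datasets below is sigma-finite. -/
instance labelMeasurableSingletonClass : MeasurableSingletonClass ℤˣ :=
  ⟨fun a => ⟨{(a : ℤ)}, measurableSet_singleton _, by ext b; simp [Units.ext_iff]⟩⟩

/-- A labelled sample: a feature vector in `ℝ^D` with its Euclidean norm, and a label which is
a unit of `ℤ`, that is, `1` or `-1`. -/
abbrev Sample (D : ℕ) : Type := EuclideanSpace ℝ (Fin D) × ℤˣ

/-- The classification margin of the linear predictor `w` on the sample `(x, y)`, namely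
the label times the inner product of `w` and `x`. -/
def margin {D : ℕ} (w : EuclideanSpace ℝ (Fin D)) (s : Sample D) : ℝ :=
  ((s.2 : ℤ) : ℝ) * inner ℝ w s.1

/-- A collection of `T` tasks; the dataset of task `m` consists of `N m` labelled samples. -/
abbrev Datasets (D T : ℕ) (N : Fin T → ℕ) : Type := (m : Fin T) → Fin (N m) → Sample D

/-- The reference measure on collections of datasets: the product, over all samples, of
Lebesgue measure on the feature vector and counting measure on the label. -/
def datasetMeasure (D T : ℕ) (N : Fin T → ℕ) : Measure (Datasets D T N) :=
  Measure.pi fun m => Measure.pi fun _ : Fin (N m) =>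
    (volume : Measure (EuclideanSpace ℝ (Fin D))).prod (Measure.count : Measure ℤˣ)

/-- The feasible set of a dataset: all predictors with margin at least one on every sample. -/
def feasibleSet {D n : ℕ} (S : Fin n → Sample D) : Set (EuclideanSpace ℝ (Fin D)) :=
  {w | ∀ i, 1 ≤ margin w (S i)}

/-- A dataset is separable if its feasible set is nonempty. -/
def Separable {D n : ℕ} (S : Fin n → Sample D) : Prop := (feasibleSet S).Nonempty

/-- The exponential loss of a dataset plus the unweighted `L2` penalty of strength `l` that
biases towards the previous iterate `v`. -/
def regularizedObjective {D n : ℕ} (S : Fin n → Sample D) (l : ℝ)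
    (v w : EuclideanSpace ℝ (Fin D)) : ℝ :=
  ∑ i, Real.exp (-margin w (S i)) + l / 2 * ‖w - v‖ ^ 2

/-- Regularized continual learning with constant strength `l`: start at zero; the iterate of
index `t + 1` minimizes the regularized objective of the task `τ t` learned at that iteration. -/
structure IsRegularizedRun {D T : ℕ} {N : Fin T → ℕ} (S : Datasets D T N) (τ : ℕ → Fin T)
    (l : ℝ) (w : ℕ → EuclideanSpace ℝ (Fin D)) : Prop where
  init : w 0 = 0
  step : ∀ t, IsMinOn (regularizedObjective (S (τ t)) l (w t)) Set.univ (w (t + 1))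

/-- Sequential Max-Margin: start at zero; the iterate of index `t + 1` is the point of the
feasible set of the task `τ t` that is nearest to the previous iterate. -/
structure IsMaxMarginRun {D T : ℕ} {N : Fin T → ℕ} (S : Datasets D T N) (τ : ℕ → Fin T)
    (w : ℕ → EuclideanSpace ℝ (Fin D)) : Prop where
  init : w 0 = 0
  feasible : ∀ t, w (t + 1) ∈ feasibleSet (S (τ t))
  step : ∀ t, IsMinOn (fun u => ‖u - w t‖ ^ 2) (feasibleSet (S (τ t))) (w (t + 1))

/-- The direction of a vector (used only for nonzero vectors). -/
def direction {D : ℕ} (w : EuclideanSpace ℝ (Fin D)) : EuclideanSpace ℝ (Fin D) :=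
  ‖w‖⁻¹ • w

end

/-! Fix a separable collection and write λ = exp(-L), so that L = ln(1/λ). A regularized step is a
soft version of projecting onto the feasible set scaled by L. Stationarity at its minimizer u,
started from L • p, reads u - L • p = ∑ β i • z i, where β i = exp(L - ⟪z i, u⟫) behaves like a
Lagrange multiplier. A separating vector bounds these multipliers by a constant times L, so every
margin of u is at least L - O(log L). This makes u an exact projection, of a point within O(1) of L
• p, onto a polyhedron whose right-hand sides differ from L by O(log L). Projections onto polyhedra
with fixed normals are Lipschitz in the right-hand sides, uniformly in the projected point
(`exists_lipschitz_projection_polyhedron`). Hence one step errs by O(log L + 1 + d), where d is the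
max-margin displacement (`exists_norm_proximal_sub_projection_le`). Proximal maps are nonexpansive
(`proximal_nonexpansive`), so these errors merely add up. The displacements sum to O(t) by a
telescoping estimate (`IsProjection.norm_sub_le_telescoping`), which gives C t log L. The claims on
directions follow because ‖w t‖ is bounded below for t ≥ 1 (`IsMaxMarginRun.exists_le_norm`). -/

/-- `x` is the metric projection of `p` onto the convex set `C`, in the form of the obtuse angle
criterion. -/
def IsProjection {E : Type*} [NormedAddCommGroup E] [InnerProductSpace ℝ E]
    (C : Set E) (p x : E) : Prop :=
  x ∈ C ∧ ∀ y ∈ C, inner ℝ (p - x) (y - x) ≤ 0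

/-- The polyhedron cut out by the inequalities `b i ≤ ⟪z i, x⟫`. -/
def polyhedron {E ι : Type*} [NormedAddCommGroup E] [InnerProductSpace ℝ E]
    (z : ι → E) (b : ι → ℝ) : Set E :=
  {x | ∀ i, b i ≤ inner ℝ (z i) x}

/-! ### Metric projections onto convex sets. -/

namespace IsProjection

variable {E : Type*} [NormedAddCommGroup E] [InnerProductSpace ℝ E] {C : Set E} {p p' x x' y : E}

theorem norm_sub_sq_add_le (h : IsProjection C p x) (hy : y ∈ C) :
    ‖y - x‖ ^ 2 + ‖x - p‖ ^ 2 ≤ ‖y - p‖ ^ 2 := by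
  have h1 := h.2 y hy
  have h2 : y - p = (y - x) - (p - x) := by abel
  have h3 := norm_sub_sq_real (y - x) (p - x)
  rw [h2, h3, norm_sub_rev x p, real_inner_comm]
  linarith

theorem norm_sub_le (h : IsProjection C p x) (hy : y ∈ C) : ‖x - p‖ ≤ ‖y - p‖ := by
  have := h.norm_sub_sq_add_le hy
  refine le_of_sq_le_sq ?_ (norm_nonneg _)
  nlinarith [sq_nonneg ‖y - x‖]

theorem isMinOn (h : IsProjection C p x) : IsMinOn (fun u => ‖u - p‖ ^ 2) C x := by
  intro y hy
  have := h.norm_sub_sq_add_le hy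
  change ‖x - p‖ ^ 2 ≤ ‖y - p‖ ^ 2
  nlinarith [sq_nonneg ‖y - x‖]

theorem nonexpansive (h : IsProjection C p x) (h' : IsProjection C p' x') :
    ‖x - x'‖ ≤ ‖p - p'‖ := by
  have h1 := h.2 x' h'.1
  have h2 := h'.2 x h.1
  have h3 : inner ℝ (x - x') (x - x') ≤ inner ℝ (p - p') (x - x') := by
    have e1 : inner ℝ (p - x) (x' - x) = - inner ℝ (p - x) (x - x') := by
      rw [← inner_neg_right]; congr 1; abel
    have e2 : p - p' = (p - x) - (p' - x') + (x - x') := by abel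
    rw [e2, inner_add_left, inner_sub_left (p - x) (p' - x')]
    linarith
  rw [real_inner_self_eq_norm_sq] at h3
  have h4 := real_inner_le_norm (p - p') (x - x')
  by_contra! hc
  have : 0 < ‖x - x'‖ := (norm_nonneg _).trans_lt hc
  nlinarith

theorem unique (h : IsProjection C p x) (h' : IsProjection C p x') : x = x' := by
  have := h.nonexpansive h'
  rw [sub_self, norm_zero] at this
  exact sub_eq_zero.1 (norm_le_zero_iff.1 this)

theorem of_isMinOn (hC : Convex ℝ C) (hx : x ∈ C)
    (h : IsMinOn (fun u => ‖u - p‖ ^ 2) C x) : IsProjection C p x := by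
  refine ⟨hx, fun y hy => ?_⟩
  by_contra! hc
  have key : ∀ s : ℝ, 0 < s → s ≤ 1 → 2 * inner ℝ (p - x) (y - x) ≤ s * ‖y - x‖ ^ 2 := by
    intro s hs hs1
    have hm : x + s • (y - x) ∈ C := hC.add_smul_sub_mem hx hy ⟨hs.le, hs1⟩
    have h1 : ‖x - p‖ ^ 2 ≤ ‖x + s • (y - x) - p‖ ^ 2 := h hm
    have h2 : x + s • (y - x) - p = s • (y - x) - (p - x) := by abel
    rw [h2, norm_sub_sq_real (s • (y - x)), norm_sub_rev x p, real_inner_smul_left, norm_smul, mul_pow,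
      Real.norm_eq_abs, sq_abs, real_inner_comm] at h1
    have : s * (2 * inner ℝ (p - x) (y - x)) ≤ s * (s * ‖y - x‖ ^ 2) := by linarith
    exact le_of_mul_le_mul_left this hs
  set c := inner ℝ (p - x) (y - x)
  have hn := sq_nonneg ‖y - x‖
  -- For this step length the right side of `key` is at most c, so 2c ≤ c, against c > 0.
  have h1 := key (min 1 (c / (‖y - x‖ ^ 2 + 1))) (by positivity) (min_le_left _ _)
  have h2 : min 1 (c / (‖y - x‖ ^ 2 + 1)) * ‖y - x‖ ^ 2 ≤ c / (‖y - x‖ ^ 2 + 1) * ‖y - x‖ ^ 2 :=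
    mul_le_mul_of_nonneg_right (min_le_right _ _) hn
  have h3 : c / (‖y - x‖ ^ 2 + 1) * ‖y - x‖ ^ 2 ≤ c := by
    rw [div_mul_eq_mul_div, div_le_iff₀ (by positivity)]
    nlinarith
  linarith

theorem exists_of_isClosed [CompleteSpace E] (hne : C.Nonempty) (hcl : IsClosed C)
    (hC : Convex ℝ C) (p : E) : ∃ x, IsProjection C p x := by
  obtain ⟨x, hx, h⟩ := exists_norm_eq_iInf_of_complete_convex hne hcl.isComplete hC p
  exact ⟨x, hx, (norm_eq_iInf_iff_real_inner_le_zero hC hx).1 h⟩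

theorem smul (h : IsProjection C p x) {c : ℝ} (hc : 0 < c) :
    IsProjection ((fun u => c⁻¹ • u) ⁻¹' C) (c • p) (c • x) := by
  refine ⟨by simpa [smul_smul, hc.ne'] using h.1, fun y hy => ?_⟩
  have h1 := h.2 _ hy
  have h2 : y - c • x = c • (c⁻¹ • y - x) := by
    rw [smul_sub, smul_smul, mul_inv_cancel₀ hc.ne', one_smul]
  rw [← smul_sub, h2, real_inner_smul_left, real_inner_smul_right]
  exact mul_nonpos_of_nonneg_of_nonpos hc.le (mul_nonpos_of_nonneg_of_nonpos hc.le h1)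

end IsProjection

/-! ### Projections onto polyhedra and their dependence on the right-hand sides. -/

section Polyhedron

variable {E ι : Type*} [NormedAddCommGroup E] [InnerProductSpace ℝ E]

theorem convex_polyhedron (z : ι → E) (b : ι → ℝ) : Convex ℝ (polyhedron z b) := by
  intro x hx y hy s t hs ht hst i
  rw [inner_add_right, real_inner_smul_right, real_inner_smul_right]
  have h1 := mul_le_mul_of_nonneg_left (hx i) hs
  have h2 := mul_le_mul_of_nonneg_left (hy i) ht
  have : s * b i + t * b i = b i := by rw [← add_mul, hst, one_mul]
  linarith

theorem isClosed_polyhedron (z : ι → E) (b : ι → ℝ) : IsClosed (polyhedron z b) := by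
  have : polyhedron z b = ⋂ i, {x | b i ≤ inner ℝ (z i) x} := by
    ext x; simp [polyhedron]
  rw [this]
  exact isClosed_iInter fun i => isClosed_le continuous_const (by fun_prop)

/-- Moving along a separating vector repairs any change of the right-hand sides, at a cost
proportional to the change. -/
theorem add_smul_mem_polyhedron {z : ι → E} {b b' : ι → ℝ} {e x : E} {r : ℝ}
    (he : ∀ i, 1 ≤ inner ℝ (z i) e) (hx : x ∈ polyhedron z b) (hr : 0 ≤ r)
    (hb : ∀ i, |b i - b' i| ≤ r) : x + r • e ∈ polyhedron z b' := by
  intro i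
  rw [inner_add_right, real_inner_smul_right]
  have h1 := hx i
  have h2 := mul_le_mul_of_nonneg_left (he i) hr
  have h3 := (abs_le.1 (hb i)).1
  linarith

/-- A point which satisfies the Karush-Kuhn-Tucker conditions is the projection. -/
theorem isProjection_polyhedron_of_sum [Fintype ι] {z : ι → E} {b : ι → ℝ} {p x : E}
    (hx : x ∈ polyhedron z b) (a : ι → ℝ) (ha : ∀ i, 0 ≤ a i)
    (hab : ∀ i, a i * (inner ℝ (z i) x - b i) = 0) (hsum : x = p + ∑ i, a i • z i) :
    IsProjection (polyhedron z b) p x := by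
  refine ⟨hx, fun y hy => ?_⟩
  have h1 : p - x = - ∑ i, a i • z i := by
    nth_rewrite 1 [hsum]; abel
  rw [h1, inner_neg_left, sum_inner, neg_nonpos]
  refine Finset.sum_nonneg fun i _ => ?_
  rw [real_inner_smul_left, inner_sub_right]
  have h2 := mul_nonneg (ha i) (sub_nonneg.2 (hy i))
  linarith [hab i]

/-- The displacement of a projection onto a polyhedron is spanned by the active normals. -/
theorem IsProjection.sub_mem_span [Finite ι] [FiniteDimensional ℝ E] {z : ι → E} {b : ι → ℝ}
    {p x : E} (h : IsProjection (polyhedron z b) p x) :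
    x - p ∈ Submodule.span ℝ (z '' {i | inner ℝ (z i) x = b i}) := by
  set J := {i | inner ℝ (z i) x = b i}
  rw [← Submodule.orthogonal_orthogonal (Submodule.span ℝ (z '' J)), Submodule.mem_orthogonal]
  -- A small step orthogonal to the active normals stays feasible: active constraints do not change
  -- and inactive ones have slack. Using v and -v then gives p - x ⟂ v.
  have key : ∀ v ∈ (Submodule.span ℝ (z '' J))ᗮ, inner ℝ (p - x) v ≤ 0 := by
    intro v hv
    have hv' : ∀ i ∈ J, inner ℝ (z i) v = 0 := fun i hi =>
      Submodule.inner_right_of_mem_orthogonal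
        (Submodule.subset_span (Set.mem_image_of_mem z hi)) hv
    have hev : ∀ᶠ s : ℝ in 𝓝[>] 0, ∀ i, b i ≤ inner ℝ (z i) (x + s • v) := by
      rw [eventually_all]
      intro i
      by_cases hi : i ∈ J
      · refine Eventually.of_forall fun s => ?_
        rw [inner_add_right, real_inner_smul_right, hv' i hi, mul_zero, add_zero]
        exact h.1 i
      · have hlt : b i < inner ℝ (z i) x := lt_of_le_of_ne (h.1 i) fun hh => hi hh.symm
        have hc : Tendsto (fun s : ℝ => inner ℝ (z i) (x + s • v)) (𝓝[>] 0)
            (𝓝 (inner ℝ (z i) x)) := by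
          have : Continuous fun s : ℝ => inner ℝ (z i) (x + s • v) := by fun_prop
          simpa using (this.tendsto 0).mono_left nhdsWithin_le_nhds
        filter_upwards [hc.eventually (lt_mem_nhds hlt)] with s hs using hs.le
    obtain ⟨s, hs, hs0⟩ := (hev.and self_mem_nhdsWithin).exists
    have h1 := h.2 _ hs
    rw [add_sub_cancel_left, real_inner_smul_right] at h1
    exact nonpos_of_mul_nonpos_right h1 hs0
  intro v hv
  have h1 := key v hv
  have h2 := key (-v) (Submodule.neg_mem _ hv)
  rw [inner_neg_right] at h2
  have h3 : inner ℝ (p - x) v = 0 := by linarith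
  rw [← neg_sub, inner_neg_right, real_inner_comm, h3, neg_zero]

/-- A vector in the span of finitely many vectors is controlled by its inner products with
these, uniformly over all subfamilies. -/
theorem exists_norm_le_of_mem_span [Finite ι] [FiniteDimensional ℝ E] (z : ι → E) :
    ∃ K : ℝ, 0 ≤ K ∧ ∀ (J : Set ι) (v : E) (r : ℝ), v ∈ Submodule.span ℝ (z '' J) → 0 ≤ r →
      (∀ i ∈ J, |inner ℝ (z i) v| ≤ r) → ‖v‖ ≤ K * r := by
  have := Fintype.ofFinite ι
  have hJ : ∀ J : Set ι, ∃ K : ℝ, 0 ≤ K ∧ ∀ (v : E) (r : ℝ), v ∈ Submodule.span ℝ (z '' J) →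
      0 ≤ r → (∀ i ∈ J, |inner ℝ (z i) v| ≤ r) → ‖v‖ ≤ K * r := by
    intro J
    have := Fintype.ofFinite J
    -- The inner products with the z i, i ∈ J, are injective on their span: a vector in the kernel
    -- is orthogonal to itself. In finite dimension this yields an antilipschitz bound.
    let A : Submodule.span ℝ (z '' J) →ₗ[ℝ] (J → ℝ) :=
      LinearMap.pi fun i => (innerₗ E (z i)).comp (Submodule.span ℝ (z '' J)).subtype
    have hA : LinearMap.ker A = ⊥ := by
      rw [LinearMap.ker_eq_bot']
      intro v hv
      have h1 : ∀ i ∈ J, inner ℝ (z i) (v : E) = 0 := fun i hi => congrFun hv ⟨i, hi⟩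
      have h2 : (v : E) ∈ (Submodule.span ℝ (z '' J))ᗮ := by
        rw [Submodule.mem_orthogonal]
        intro u hu
        induction hu using Submodule.span_induction with
        | mem u hu => obtain ⟨i, hi, rfl⟩ := hu; exact h1 i hi
        | zero => simp
        | add u w _ _ hu hw => rw [inner_add_left, hu, hw, add_zero]
        | smul c u _ hu => rw [real_inner_smul_left, hu, mul_zero]
      have h3 := (Submodule.mem_orthogonal _ _).1 h2 v v.2
      exact Subtype.ext (inner_self_eq_zero.1 h3)
    obtain ⟨K, -, hK⟩ := A.exists_antilipschitzWith hA
    refine ⟨K, K.2, fun v r hv hr h => ?_⟩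
    have h1 := hK.le_mul_dist ⟨v, hv⟩ 0
    rw [map_zero, dist_zero_right, dist_zero_right] at h1
    have h2 : ‖A ⟨v, hv⟩‖ ≤ r := (pi_norm_le_iff_of_nonneg hr).2 fun i => h i i.2
    exact h1.trans (mul_le_mul_of_nonneg_left h2 K.2)
  choose K hK0 hK using hJ
  have hfin := Fintype.ofFinite (Set ι)
  -- There are finitely many subfamilies, and the sum dominates each constant.
  refine ⟨∑ J, K J, Finset.sum_nonneg fun J _ => hK0 J, fun J v r hv hr h => ?_⟩
  refine (hK J v r hv hr h).trans (mul_le_mul_of_nonneg_right ?_ hr)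
  exact Finset.single_le_sum (f := K) (fun J _ => hK0 J) (Finset.mem_univ J)

/-- Continuity of the projection onto a polyhedron in the right-hand sides. -/
theorem IsProjection.norm_sub_le_of_abs_sub_le {z : ι → E} {b b' : ι → ℝ} {e p x x' : E} {r : ℝ}
    (he : ∀ i, 1 ≤ inner ℝ (z i) e) (hr : 0 ≤ r) (hb : ∀ i, |b i - b' i| ≤ r)
    (h : IsProjection (polyhedron z b) p x) (h' : IsProjection (polyhedron z b') p x') :
    ‖x - x'‖ ≤ r * ‖e‖ + √(4 * (r * ‖e‖) * (‖x - p‖ + 2 * (r * ‖e‖))) := by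
  have hre : ‖r • e‖ = r * ‖e‖ := by rw [norm_smul, Real.norm_of_nonneg hr]
  have h0 : 0 ≤ r * ‖e‖ := by positivity
  have h1 := h'.norm_sub_sq_add_le (add_smul_mem_polyhedron he h.1 hr hb)
  have h2 := h.norm_sub_le (add_smul_mem_polyhedron he h'.1 hr
    (fun i => by rw [abs_sub_comm]; exact hb i))
  have h3 : ‖x' + r • e - p‖ ≤ ‖x' - p‖ + r * ‖e‖ := by
    rw [← hre, add_sub_right_comm]; exact norm_add_le _ _
  have h4 : ‖x + r • e - p‖ ≤ ‖x - p‖ + r * ‖e‖ := by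
    rw [← hre, add_sub_right_comm]; exact norm_add_le _ _
  have h5 : ‖x + r • e - p‖ ^ 2 ≤ (‖x - p‖ + r * ‖e‖) ^ 2 :=
    pow_le_pow_left₀ (norm_nonneg _) h4 2
  -- With ρ = r‖e‖, the two shifted points show that the distances from p to the polyhedra differ by
  -- at most ρ. The obtuse-angle inequality turns this into a bound of order √ρ, enough for
  -- continuity.
  have h6 : ‖x + r • e - x'‖ ^ 2 ≤ 4 * (r * ‖e‖) * (‖x - p‖ + 2 * (r * ‖e‖)) := by
    have h7 : ‖x - p‖ ≤ ‖x' - p‖ + r * ‖e‖ := h2.trans h3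
    rcases le_total (‖x - p‖) (r * ‖e‖) with hc | hc
    · nlinarith [norm_nonneg (x - p), sq_nonneg ‖x' - p‖]
    · nlinarith [norm_nonneg (x - p), norm_nonneg (x' - p)]
  have h8 : x - x' = (x + r • e - x') - r • e := by abel
  have h9 := _root_.norm_sub_le (x + r • e - x') (r • e)
  rw [← h8, hre] at h9
  linarith [Real.le_sqrt_of_sq_le h6]

/-- The projection onto a polyhedron with a strictly feasible direction is Lipschitz in the
right-hand sides, uniformly in the projected point. -/
theorem exists_lipschitz_projection_polyhedron [Finite ι] [FiniteDimensional ℝ E] (z : ι → E)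
    {e : E} (he : ∀ i, 1 ≤ inner ℝ (z i) e) :
    ∃ K : ℝ, 0 ≤ K ∧ ∀ (b b' : ι → ℝ) (p x x' : E) (r : ℝ), 0 ≤ r → (∀ i, |b i - b' i| ≤ r) →
      IsProjection (polyhedron z b) p x → IsProjection (polyhedron z b') p x' →
      ‖x - x'‖ ≤ K * r := by
  obtain ⟨K, hK0, hK⟩ := exists_norm_le_of_mem_span z
  refine ⟨K, hK0, fun b b' p x x' r hr hb hx hx' => ?_⟩
  have := Fintype.ofFinite ι
  have : CompleteSpace E := FiniteDimensional.complete ℝ E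
  -- Join b to b' by a segment and follow the projection f s of p. While one active set persists, f
  -- moves at Lipschitz speed.
  set c : ℝ → ι → ℝ := fun s i => b i + s * (b' i - b i) with hc
  have hne : ∀ s, (polyhedron z (c s)).Nonempty := by
    intro s
    refine ⟨(0 : E) + (∑ i, |c s i|) • e, add_smul_mem_polyhedron (b := 0) he ?_
      (Finset.sum_nonneg fun i _ => abs_nonneg _) fun i => ?_⟩
    · intro i; simp
    · rw [Pi.zero_apply, zero_sub, abs_neg]
      exact Finset.single_le_sum (f := fun i => |c s i|) (fun i _ => abs_nonneg _)
        (Finset.mem_univ i)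
  choose f hf using fun s => IsProjection.exists_of_isClosed (hne s)
    (isClosed_polyhedron z (c s)) (convex_polyhedron z (c s)) p
  have hdiff : ∀ s t i, |c s i - c t i| ≤ |s - t| * r := by
    intro s t i
    have : c s i - c t i = (s - t) * (b' i - b i) := by simp only [hc]; ring
    rw [this, abs_mul, abs_sub_comm (b' i)]
    exact mul_le_mul_of_nonneg_left (hb i) (abs_nonneg _)
  have hcont : Continuous f := by
    rw [continuous_iff_continuousAt]
    intro s
    rw [ContinuousAt, tendsto_iff_norm_sub_tendsto_zero]
    have hlim : Tendsto (fun t : ℝ => |s - t| * r * ‖e‖ +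
        √(4 * (|s - t| * r * ‖e‖) * (‖f s - p‖ + 2 * (|s - t| * r * ‖e‖)))) (𝓝 s) (𝓝 0) := by
      have : Continuous fun t : ℝ => |s - t| * r * ‖e‖ +
        √(4 * (|s - t| * r * ‖e‖) * (‖f s - p‖ + 2 * (|s - t| * r * ‖e‖))) := by fun_prop
      simpa using this.tendsto s
    refine squeeze_zero (fun _ => norm_nonneg _) (fun t => ?_) hlim
    rw [norm_sub_rev]
    exact IsProjection.norm_sub_le_of_abs_sub_le he (by positivity) (hdiff s t) (hf s) (hf t)
  -- Continuous induction on the segment: the estimate is closed in s, and from each s it need only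
  -- extend to some later t arbitrarily close.
  have hsub : Set.Icc (0 : ℝ) 1 ⊆ {s | ‖f s - f 0‖ ≤ K * (s * r)} := by
    refine IsClosed.Icc_subset_of_forall_exists_gt ?_ (by simp) ?_
    · refine IsClosed.inter ?_ isClosed_Icc
      exact isClosed_le (by fun_prop) (by fun_prop)
    · rintro s ⟨hs, hs01⟩ y hy
      -- By pigeonhole, one active set J recurs for t arbitrarily close to s from the right. Its
      -- equalities and the span condition pass to the limit s by continuity of f, although more
      -- constraints may be active there.
      have hfreq : ∃ J : Set ι, ∃ᶠ t in 𝓝[>] s, {i | inner ℝ (z i) (f t) = c t i} = J := by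
        by_contra! hcon
        have := Fintype.ofFinite (Set ι)
        obtain ⟨t, ht⟩ := (eventually_all.2 hcon).exists
        exact ht _ rfl
      obtain ⟨J, hJ⟩ := hfreq
      have hJ' : ∃ᶠ t in 𝓝 s, {i | inner ℝ (z i) (f t) = c t i} = J :=
        hJ.filter_mono nhdsWithin_le_nhds
      have hs1 : ∀ i ∈ J, inner ℝ (z i) (f s) = c s i := by
        intro i hi
        have hcl : IsClosed {t | inner ℝ (z i) (f t) = c t i} :=
          isClosed_eq (by fun_prop) (by simp only [hc]; fun_prop)
        refine hcl.mem_of_frequently_of_tendsto (hJ'.mono fun t ht => ?_) tendsto_id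
        have : i ∈ {i | inner ℝ (z i) (f t) = c t i} := ht ▸ hi
        exact this
      have hs2 : f s - p ∈ Submodule.span ℝ (z '' J) := by
        have hcl : IsClosed {t | f t - p ∈ Submodule.span ℝ (z '' J)} :=
          (Submodule.closed_of_finiteDimensional _).preimage (by fun_prop)
        exact hcl.mem_of_frequently_of_tendsto
          (hJ'.mono fun t ht => ht ▸ (hf t).sub_mem_span) tendsto_id
      have hy' : ∀ᶠ t in 𝓝[>] s, t ∈ Set.Ioc s y := Ioc_mem_nhdsGT hy
      obtain ⟨t, ht, hty⟩ := (hJ.and_eventually hy').exists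
      refine ⟨t, ?_, hty⟩
      have ht1 : ∀ i ∈ J, inner ℝ (z i) (f t) = c t i := by
        intro i hi
        have : i ∈ {i | inner ℝ (z i) (f t) = c t i} := ht ▸ hi
        exact this
      have ht2 : f t - p ∈ Submodule.span ℝ (z '' J) := ht ▸ (hf t).sub_mem_span
      have hv : f t - f s ∈ Submodule.span ℝ (z '' J) := by
        have := Submodule.sub_mem _ ht2 hs2
        rwa [sub_sub_sub_cancel_right] at this
      have hts : 0 ≤ t - s := by linarith [hty.1]
      have h1 := hK J _ ((t - s) * r) hv (by positivity) fun i hi => by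
        rw [inner_sub_right, ht1 i hi, hs1 i hi]
        simpa [abs_of_nonneg hts] using hdiff t s i
      have hs' : ‖f s - f 0‖ ≤ K * (s * r) := hs
      have h2 := norm_sub_le_norm_sub_add_norm_sub (f t) (f s) (f 0)
      change ‖f t - f 0‖ ≤ K * (t * r)
      linarith
  have h0 : f 0 = x := (hf 0).unique (by simpa [hc] using hx)
  have h1 : f 1 = x' := (hf 1).unique (by simpa [hc] using hx')
  have := hsub (Set.right_mem_Icc.2 zero_le_one)
  rw [Set.mem_ofPred_eq, h0, h1, one_mul, norm_sub_rev] at this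
  exact this

end Polyhedron

theorem IsProjection.smul_polyhedron {E ι : Type*} [NormedAddCommGroup E]
    [InnerProductSpace ℝ E] {z : ι → E} {p q : E}
    (h : IsProjection (polyhedron z fun _ => 1) p q) {c : ℝ} (hc : 0 < c) :
    IsProjection (polyhedron z fun _ => c) (c • p) (c • q) := by
  have : (fun u => c⁻¹ • u) ⁻¹' polyhedron z (fun _ => 1) = polyhedron z fun _ => c := by
    ext u
    refine forall_congr' fun i => ?_
    rw [real_inner_smul_right, inv_mul_eq_div, le_div_iff₀ hc, one_mul]
  exact this ▸ h.smul hc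

/-! ### Proximal steps for the exponential loss. -/

section Proximal

variable {E ι : Type*} [NormedAddCommGroup E] [InnerProductSpace ℝ E] [Fintype ι]

/-- The objective of a proximal step for the exponential loss with features `z`. -/
noncomputable def proximalObjective (z : ι → E) (l : ℝ) (v w : E) : ℝ :=
  ∑ i, Real.exp (-inner ℝ (z i) w) + l / 2 * ‖w - v‖ ^ 2

theorem exists_isMinOn_proximalObjective [FiniteDimensional ℝ E] (z : ι → E) {l : ℝ} (hl : 0 < l)
    (v : E) : ∃ w, IsMinOn (proximalObjective z l v) Set.univ w := by
  have hcont : Continuous (proximalObjective z l v) := by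
    unfold proximalObjective; fun_prop
  have hlim : Tendsto (proximalObjective z l v) (cocompact E) atTop := by
    have h1 : Tendsto (fun w : E => ‖w - v‖) (cocompact E) atTop := by
      have h2 : Tendsto (fun w : E => ‖w‖ - ‖v‖) (cocompact E) atTop :=
        tendsto_atTop_add_const_right _ _ (tendsto_norm_cocompact_atTop)
      exact tendsto_atTop_mono (fun w => norm_sub_norm_le w v) h2
    have h2 : Tendsto (fun w : E => l / 2 * ‖w - v‖ ^ 2) (cocompact E) atTop :=
      ((tendsto_pow_atTop two_ne_zero).comp h1).const_mul_atTop (by positivity)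
    refine tendsto_atTop_mono (fun w => ?_) h2
    exact le_add_of_nonneg_left (Finset.sum_nonneg fun i _ => (Real.exp_pos _).le)
  obtain ⟨w, hw⟩ := hcont.exists_forall_le hlim
  exact ⟨w, fun y _ => hw y⟩

/-- The stationarity condition for a proximal step. -/
theorem sub_eq_sum_of_isMinOn_proximalObjective {z : ι → E} {l : ℝ} (hl : 0 < l) {v w : E}
    (h : IsMinOn (proximalObjective z l v) Set.univ w) :
    w - v = ∑ i, (l⁻¹ * Real.exp (-inner ℝ (z i) w)) • z i := by
  refine ext_inner_right ℝ fun u => ?_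
  have hd : HasDerivAt (fun s : ℝ => proximalObjective z l v (w + s • u))
      (∑ i, Real.exp (-inner ℝ (z i) w) * (-inner ℝ (z i) u) + l * inner ℝ (w - v) u) 0 := by
    have h1 : ∀ i, HasDerivAt (fun s : ℝ => Real.exp (-inner ℝ (z i) (w + s • u)))
        (Real.exp (-inner ℝ (z i) w) * (-inner ℝ (z i) u)) 0 := by
      intro i
      have h2 : HasDerivAt (fun s : ℝ => -inner ℝ (z i) (w + s • u)) (-inner ℝ (z i) u) 0 := by
        have h3 : HasDerivAt (fun s : ℝ => -(inner ℝ (z i) w + s * inner ℝ (z i) u))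
            (-(1 * inner ℝ (z i) u)) 0 :=
          (((hasDerivAt_id (0 : ℝ)).mul_const _).const_add _).neg
        simpa [inner_add_right, real_inner_smul_right] using h3
      simpa using h2.exp
    have h4 : HasDerivAt (fun s : ℝ => l / 2 * ‖w + s • u - v‖ ^ 2) (l * inner ℝ (w - v) u) 0 := by
      have h5 : HasDerivAt (fun s : ℝ => w + s • u - v) u 0 := by
        simpa using (((hasDerivAt_id (0 : ℝ)).smul_const u).const_add w).sub_const v
      have h6 := h5.norm_sq.const_mul (l / 2)
      rw [zero_smul, add_zero, ← mul_assoc, div_mul_cancel₀ l two_ne_zero] at h6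
      exact h6
    exact (HasDerivAt.fun_sum fun i _ => h1 i).add h4
  have hmin : IsLocalMin (fun s : ℝ => proximalObjective z l v (w + s • u)) 0 := by
    refine Eventually.of_forall fun s => ?_
    simpa using h (Set.mem_univ (w + s • u))
  have h0 := hmin.hasDerivAt_eq_zero hd
  rw [sum_inner]
  have h7 : l * inner ℝ (w - v) u = ∑ i, Real.exp (-inner ℝ (z i) w) * inner ℝ (z i) u := by
    simp only [mul_neg, Finset.sum_neg_distrib] at h0
    linarith
  have h8 : inner ℝ (w - v) u = l⁻¹ * (l * inner ℝ (w - v) u) := by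
    rw [← mul_assoc, inv_mul_cancel₀ hl.ne', one_mul]
  rw [h8, h7, Finset.mul_sum]
  refine Finset.sum_congr rfl fun i _ => ?_
  rw [real_inner_smul_left, mul_assoc]

/-- Proximal steps do not increase distances. -/
theorem proximal_nonexpansive {z : ι → E} {l : ℝ} (hl : 0 < l) {v v' w w' : E}
    (h : IsMinOn (proximalObjective z l v) Set.univ w)
    (h' : IsMinOn (proximalObjective z l v') Set.univ w') : ‖w - w'‖ ≤ ‖v - v'‖ := by
  have h1 := sub_eq_sum_of_isMinOn_proximalObjective hl h
  have h2 := sub_eq_sum_of_isMinOn_proximalObjective hl h'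
  -- Since exp(-x) is decreasing in x, each sample contributes a nonpositive term.
  have h3 : inner ℝ ((w - v) - (w' - v')) (w - w') ≤ 0 := by
    rw [h1, h2, ← Finset.sum_sub_distrib, sum_inner]
    refine Finset.sum_nonpos fun i _ => ?_
    rw [← sub_smul, real_inner_smul_left, ← mul_sub, mul_assoc, inner_sub_right]
    refine mul_nonpos_of_nonneg_of_nonpos (inv_pos.2 hl).le ?_
    rcases le_total (inner ℝ (z i) w) (inner ℝ (z i) w') with hc | hc
    · exact mul_nonpos_of_nonneg_of_nonpos
        (sub_nonneg.2 (Real.exp_le_exp.2 (neg_le_neg hc))) (sub_nonpos.2 hc)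
    · exact mul_nonpos_of_nonpos_of_nonneg
        (sub_nonpos.2 (Real.exp_le_exp.2 (neg_le_neg hc))) (sub_nonneg.2 hc)
  have h4 : (w - v) - (w' - v') = (w - w') - (v - v') := by abel
  rw [h4, inner_sub_left, real_inner_self_eq_norm_sq] at h3
  have h5 := real_inner_le_norm (v - v') (w - w')
  by_contra! hc
  have : 0 < ‖w - w'‖ := (norm_nonneg _).trans_lt hc
  nlinarith

theorem existsUnique_isMinOn_proximalObjective [FiniteDimensional ℝ E] (z : ι → E) {l : ℝ}
    (hl : 0 < l) (v : E) : ∃! w, IsMinOn (proximalObjective z l v) Set.univ w := by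
  obtain ⟨w, hw⟩ := exists_isMinOn_proximalObjective z hl v
  refine ⟨w, hw, fun w' hw' => ?_⟩
  have := proximal_nonexpansive hl hw' hw
  rw [sub_self, norm_zero] at this
  exact sub_eq_zero.1 (norm_le_zero_iff.1 this)

/-- A proximal step with penalty `exp (-L)` stays close to the projection onto the max-margin
polyhedron scaled by `L`. -/
theorem exists_norm_proximal_sub_projection_le [FiniteDimensional ℝ E] (z : ι → E) {e : E}
    (he : ∀ i, 1 ≤ inner ℝ (z i) e) :
    ∃ A : ℝ, 0 ≤ A ∧ ∀ (L : ℝ) (p q u : E), 1 ≤ L →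
      IsProjection (polyhedron z fun _ => 1) p q →
      IsMinOn (proximalObjective z (Real.exp (-L)) (L • p)) Set.univ u →
      ‖u - L • q‖ ≤ A * (Real.log L + 1 + ‖q - p‖) := by
  obtain ⟨K, hK0, hK⟩ := exists_lipschitz_projection_polyhedron z he
  set n : ℝ := (Fintype.card ι : ℝ) with hn
  have hn0 : 0 ≤ n := by positivity
  set Z : ℝ := ∑ i, ‖z i‖ with hZ
  have hZ0 : 0 ≤ Z := Finset.sum_nonneg fun i _ => norm_nonneg _
  refine ⟨K + K * (‖e‖ * (2 * n)) + K * ‖e‖ + Z, by positivity, fun L p q u hL hq hu => ?_⟩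
  have hL0 : 0 < L := by linarith
  have hlog : 0 ≤ Real.log L := Real.log_nonneg hL
  set d := ‖q - p‖ with hd
  have hd0 : 0 ≤ d := norm_nonneg _
  have hqL := hq.smul_polyhedron hL0
  set β : ι → ℝ := fun i => (Real.exp (-L))⁻¹ * Real.exp (-inner ℝ (z i) u) with hβ
  have hβe : ∀ i, β i = Real.exp (L - inner ℝ (z i) u) := fun i => by
    simp only [hβ]
    rw [← Real.exp_neg, ← Real.exp_add]
    congr 1; ring
  have hβ0 : ∀ i, 0 ≤ β i := fun i => by rw [hβe]; exact (Real.exp_pos _).le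
  have hsum : u - L • p = ∑ i, β i • z i :=
    sub_eq_sum_of_isMinOn_proximalObjective (Real.exp_pos _) hu
  -- Compare the objective with its value at L • q, where every margin is at least L and the loss is
  -- at most n exp(-L), of the same order as the penalty strength.
  have hdist : ‖u - L • p‖ ≤ L * (2 * n + d) := by
    have h1 : proximalObjective z (Real.exp (-L)) (L • p) u ≤
        proximalObjective z (Real.exp (-L)) (L • p) (L • q) := hu (Set.mem_univ _)
    have h2 : ∑ i, Real.exp (-inner ℝ (z i) (L • q)) ≤ n * Real.exp (-L) := by
      refine (Finset.sum_le_sum fun i _ =>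
        Real.exp_le_exp.2 (neg_le_neg (hqL.1 i))).trans ?_
      simp [hn]
    have h3 : 0 ≤ ∑ i, Real.exp (-inner ℝ (z i) u) :=
      Finset.sum_nonneg fun i _ => (Real.exp_pos _).le
    have h4 : ‖L • q - L • p‖ = L * d := by
      rw [← smul_sub, norm_smul, Real.norm_of_nonneg hL0.le]
    simp only [proximalObjective] at h1
    rw [h4] at h1
    have h5 : Real.exp (-L) * ‖u - L • p‖ ^ 2 ≤ Real.exp (-L) * (2 * n + (L * d) ^ 2) := by
      linarith
    have h6 := le_of_mul_le_mul_left h5 (Real.exp_pos _)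
    have h7 : n ≤ n ^ 2 := by
      rw [hn]; exact_mod_cast Nat.le_self_pow two_ne_zero _
    have h8 : ‖u - L • p‖ ≤ 2 * n + L * d := by
      refine le_of_sq_le_sq ?_ (by positivity)
      nlinarith [mul_nonneg hn0 (mul_nonneg hL0.le hd0)]
    nlinarith
  set r : ℝ := Real.log L + ‖e‖ * (2 * n + d) with hr
  have hr0 : 0 ≤ r := by positivity
  -- Pairing the stationarity identity with e bounds each multiplier by a constant times L(1 + d);
  -- its logarithm bounds the margin deficit. The bound x ≤ exp x keeps r linear in d, as the later
  -- telescoping requires.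
  have hmargin : ∀ i, L - r ≤ inner ℝ (z i) u := by
    intro i
    have h1 : β i ≤ inner ℝ (u - L • p) e := by
      rw [hsum, sum_inner]
      calc β i ≤ ∑ j, β j := Finset.single_le_sum (fun j _ => hβ0 j) (Finset.mem_univ i)
        _ ≤ ∑ j, inner ℝ (β j • z j) e := Finset.sum_le_sum fun j _ => by
            rw [real_inner_smul_left]
            exact le_mul_of_one_le_right (hβ0 j) (he j)
    have h2 : β i ≤ L * (‖e‖ * (2 * n + d)) := by
      refine (h1.trans (real_inner_le_norm _ _)).trans ?_
      have := mul_le_mul_of_nonneg_right hdist (norm_nonneg e)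
      linarith
    have h3 : Real.exp r = L * Real.exp (‖e‖ * (2 * n + d)) := by
      rw [hr, Real.exp_add, Real.exp_log hL0]
    have h4 : ‖e‖ * (2 * n + d) ≤ Real.exp (‖e‖ * (2 * n + d)) := by
      linarith [Real.add_one_le_exp (‖e‖ * (2 * n + d))]
    have h5 : Real.exp (L - inner ℝ (z i) u) ≤ Real.exp r := by
      rw [← hβe, h3]
      exact h2.trans (mul_le_mul_of_nonneg_left h4 hL0.le)
    linarith [Real.exp_le_exp.1 h5]
  -- Split the samples at margin L. Those below it become active constraints of the clipped
  -- polyhedron, with multipliers β i; those at or above it have β i ≤ 1 and are absorbed into the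
  -- base point p'. The Karush-Kuhn-Tucker conditions then hold exactly.
  set b : ι → ℝ := fun i => min (inner ℝ (z i) u) L with hb
  set p' : E := L • p + ∑ i, (if L ≤ inner ℝ (z i) u then β i else 0) • z i with hp'
  have hproj : IsProjection (polyhedron z b) p' u := by
    refine isProjection_polyhedron_of_sum (fun i => min_le_left _ _)
      (fun i => if L ≤ inner ℝ (z i) u then 0 else β i) (fun i => ?_) (fun i => ?_) ?_
    · split_ifs
      exacts [le_rfl, hβ0 i]
    · split_ifs with hc
      · rw [zero_mul]
      · rw [hb]; dsimp only; rw [min_eq_left (not_le.1 hc).le, sub_self, mul_zero]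
    · rw [hp', add_assoc, ← Finset.sum_add_distrib, ← sub_eq_iff_eq_add', hsum]
      refine Finset.sum_congr rfl fun i _ => ?_
      split_ifs <;> simp
  have : CompleteSpace E := FiniteDimensional.complete ℝ E
  obtain ⟨y, hy⟩ := IsProjection.exists_of_isClosed ⟨_, hqL.1⟩
    (isClosed_polyhedron z fun _ => L) (convex_polyhedron z fun _ => L) p'
  -- Two comparisons remain: change the right-hand sides from b to L, then move the base point from
  -- p' back to L • p.
  have h1 : ‖u - y‖ ≤ K * r := by
    refine hK b (fun _ => L) p' u y r hr0 (fun i => ?_) hproj hy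
    have h2 := hmargin i
    simp only [hb]
    rw [abs_le]
    constructor
    · have : L - r ≤ min (inner ℝ (z i) u) L := le_min h2 (by linarith)
      linarith
    · linarith [min_le_right (inner ℝ (z i) u) L]
  have h2 : ‖y - L • q‖ ≤ Z := by
    refine (hy.nonexpansive hqL).trans ?_
    rw [hp', add_sub_cancel_left]
    refine (norm_sum_le _ _).trans (Finset.sum_le_sum fun i _ => ?_)
    split_ifs with hc
    · rw [norm_smul, Real.norm_of_nonneg (hβ0 i)]
      refine mul_le_of_le_one_left (norm_nonneg _) ?_
      rw [hβe, Real.exp_le_one_iff]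
      linarith
    · simp
  have h3 := norm_sub_le_norm_sub_add_norm_sub u y (L • q)
  have h4 : K * r + Z ≤
      (K + K * (‖e‖ * (2 * n)) + K * ‖e‖ + Z) * (Real.log L + 1 + d) := by
    have e1 : 0 ≤ K * ‖e‖ := by positivity
    have e2 : 0 ≤ K * (‖e‖ * (2 * n)) := by positivity
    have e3 : 0 ≤ Real.log L + d := by positivity
    have e4 : 0 ≤ K * (1 + d) + K * (‖e‖ * (2 * n)) * (Real.log L + d) +
        K * ‖e‖ * (Real.log L + 1) + Z * (Real.log L + d) := by positivity
    rw [hr]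
    linarith
  linarith

end Proximal

/-! ### Recursion, telescoping and comparison of directions. -/

theorem existsUnique_seq_of_existsUnique_step {α : Type*} (a : α) {r : ℕ → α → α → Prop}
    (h : ∀ t v, ∃! w, r t v w) : ∃! w : ℕ → α, w 0 = a ∧ ∀ t, r t (w t) (w (t + 1)) := by
  choose f hf hu using h
  refine ⟨fun t => Nat.rec a (fun t v => f t v) t, ⟨rfl, fun t => hf t _⟩, fun w hw => ?_⟩
  funext t
  induction t with
  | zero => exact hw.1
  | succ t ih =>
    rw [hu t (w t) _ (hw.2 t), ih]

/-- The total displacement of successive projections grows at most linearly. -/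
theorem IsProjection.norm_sub_le_telescoping {E : Type*} [NormedAddCommGroup E]
    [InnerProductSpace ℝ E] {C : Set E} {p x e : E} {R : ℝ} (h : IsProjection C p x)
    (he : e ∈ C) (hR : 0 < R) (heR : ‖e‖ ≤ R) :
    ‖x - p‖ ≤ 2 * R + (‖p‖ ^ 2 - ‖x‖ ^ 2) / (2 * R) := by
  have h1 := h.norm_sub_sq_add_le he
  rw [norm_sub_sq_real e x, norm_sub_sq_real e p] at h1
  have h2 : inner ℝ e x - inner ℝ e p ≤ R * ‖x - p‖ := by
    rw [← inner_sub_right]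
    exact (real_inner_le_norm _ _).trans (mul_le_mul_of_nonneg_right heR (norm_nonneg _))
  rw [← sub_le_iff_le_add', le_div_iff₀ (by positivity)]
  -- With d = ‖x - p‖, the above gives d² ≤ ‖p‖² - ‖x‖² + 2Rd; then use 4Rd ≤ d² + 4R².
  nlinarith [sq_nonneg (‖x - p‖ - 2 * R)]

/-- Here a may vanish: the convention 0⁻¹ = 0 sends it to 0 and the bound persists. -/
theorem norm_inv_smul_sub_inv_smul_le {E : Type*} [NormedAddCommGroup E] [NormedSpace ℝ E]
    (a : E) {b : E} (hb : b ≠ 0) : ‖‖a‖⁻¹ • a - ‖b‖⁻¹ • b‖ ≤ 2 * (‖a - b‖ / ‖b‖) := by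
  have hb' : 0 < ‖b‖ := norm_pos_iff.2 hb
  have h1 : ‖‖a‖⁻¹ • a - ‖b‖⁻¹ • a‖ ≤ ‖a - b‖ / ‖b‖ := by
    rcases eq_or_ne a 0 with rfl | ha
    · simp [hb]
    · have ha' : 0 < ‖a‖ := norm_pos_iff.2 ha
      have h2 : (‖a‖⁻¹ - ‖b‖⁻¹) * ‖a‖ = (‖b‖ - ‖a‖) / ‖b‖ := by field_simp
      rw [← sub_smul, norm_smul, Real.norm_eq_abs, ← abs_of_pos ha', ← abs_mul,
        abs_of_pos ha', h2, abs_div, abs_of_pos hb']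
      refine div_le_div_of_nonneg_right ?_ hb'.le
      rw [norm_sub_rev]
      exact abs_norm_sub_norm_le b a
  have h3 : ‖‖b‖⁻¹ • a - ‖b‖⁻¹ • b‖ = ‖a - b‖ / ‖b‖ := by
    rw [← smul_sub, norm_smul, norm_inv, norm_norm, inv_mul_eq_div]
  linarith [norm_sub_le_norm_sub_add_norm_sub (‖a‖⁻¹ • a) (‖b‖⁻¹ • a) (‖b‖⁻¹ • b)]

/-! ### From datasets to proximal steps and projections; bounds along the runs. -/

/-- The feature vector of a sample multiplied by its label. -/
noncomputable def signedFeature {D : ℕ} (s : Sample D) : EuclideanSpace ℝ (Fin D) := ((s.2 : ℤ) : ℝ) • s.1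

theorem margin_eq_inner {D : ℕ} (w : EuclideanSpace ℝ (Fin D)) (s : Sample D) :
    margin w s = inner ℝ (signedFeature s) w := by
  rw [margin, signedFeature, real_inner_smul_left, real_inner_comm]

theorem feasibleSet_eq_polyhedron {D n : ℕ} (S : Fin n → Sample D) :
    feasibleSet S = polyhedron (fun i => signedFeature (S i)) fun _ => 1 := by
  ext w
  exact forall_congr' fun i => by rw [margin_eq_inner]

theorem regularizedObjective_eq {D n : ℕ} (S : Fin n → Sample D) (l : ℝ) :
    regularizedObjective S l = proximalObjective (fun i => signedFeature (S i)) l := by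
  ext v w
  simp only [regularizedObjective, proximalObjective, margin_eq_inner]

section Runs

variable {D T : ℕ} {N : Fin T → ℕ} {S : Datasets D T N} {τ : ℕ → Fin T}

theorem existsUnique_isMaxMarginRun (hS : ∀ m, Separable (S m)) (τ : ℕ → Fin T) :
    ∃! w : ℕ → EuclideanSpace ℝ (Fin D), IsMaxMarginRun S τ w := by
  have hconv : ∀ m, Convex ℝ (feasibleSet (S m)) := fun m =>
    feasibleSet_eq_polyhedron (S m) ▸ convex_polyhedron _ _
  have hstep : ∀ t v, ∃! w, w ∈ feasibleSet (S (τ t)) ∧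
      IsMinOn (fun u => ‖u - v‖ ^ 2) (feasibleSet (S (τ t))) w := by
    intro t v
    obtain ⟨w, hw⟩ := IsProjection.exists_of_isClosed (hS (τ t))
      (feasibleSet_eq_polyhedron (S (τ t)) ▸ isClosed_polyhedron _ _) (hconv _) v
    exact ⟨w, ⟨hw.1, hw.isMinOn⟩, fun w' hw' =>
      (IsProjection.of_isMinOn (hconv _) hw'.1 hw'.2).unique hw⟩
  obtain ⟨w, hw, hu⟩ := existsUnique_seq_of_existsUnique_step 0 hstep
  exact ⟨w, ⟨hw.1, fun t => (hw.2 t).1, fun t => (hw.2 t).2⟩,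
    fun w' hw' => hu w' ⟨hw'.init, fun t => ⟨hw'.feasible t, hw'.step t⟩⟩⟩

theorem existsUnique_isRegularizedRun (S : Datasets D T N) (τ : ℕ → Fin T) {l : ℝ} (hl : 0 < l) :
    ∃! w : ℕ → EuclideanSpace ℝ (Fin D), IsRegularizedRun S τ l w := by
  have hstep : ∀ t v, ∃! w, IsMinOn (regularizedObjective (S (τ t)) l v) Set.univ w := by
    intro t v
    rw [regularizedObjective_eq]
    exact existsUnique_isMinOn_proximalObjective _ hl v
  obtain ⟨w, hw, hu⟩ := existsUnique_seq_of_existsUnique_step 0 hstep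
  exact ⟨w, ⟨hw.1, hw.2⟩, fun w' hw' => hu w' ⟨hw'.init, hw'.step⟩⟩

theorem IsMaxMarginRun.isProjection {w : ℕ → EuclideanSpace ℝ (Fin D)}
    (hw : IsMaxMarginRun S τ w) (t : ℕ) :
    IsProjection (polyhedron (fun i => signedFeature (S (τ t) i)) fun _ => 1) (w t)
      (w (t + 1)) := by
  rw [← feasibleSet_eq_polyhedron]
  exact IsProjection.of_isMinOn (feasibleSet_eq_polyhedron (S (τ t)) ▸ convex_polyhedron _ _)
    (hw.feasible t) (hw.step t)

theorem exists_norm_regularized_sub_le (hS : ∀ m, Separable (S m)) (τ : ℕ → Fin T) :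
    ∃ C : ℝ, 0 ≤ C ∧ ∀ (L : ℝ) (w wreg : ℕ → EuclideanSpace ℝ (Fin D)), 1 ≤ Real.log L → 1 ≤ L →
      IsMaxMarginRun S τ w → IsRegularizedRun S τ (Real.exp (-L)) wreg →
      ∀ t : ℕ, ‖wreg t - L • w t‖ ≤ C * (t * Real.log L) := by
  choose e he using hS
  have he' : ∀ m i, 1 ≤ inner ℝ (signedFeature (S m i)) (e m) := fun m i => by
    rw [← margin_eq_inner]; exact he m i
  choose A hA0 hA using fun m =>
    exists_norm_proximal_sub_projection_le (fun i => signedFeature (S m i)) (he' m)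
  set B := ∑ m, A m with hB
  have hAB : ∀ m, A m ≤ B := fun m =>
    Finset.single_le_sum (fun m _ => hA0 m) (Finset.mem_univ m)
  have hB0 : 0 ≤ B := Finset.sum_nonneg fun m _ => hA0 m
  set R := 1 + ∑ m, ‖e m‖ with hR
  have heR : ∀ m, ‖e m‖ ≤ R := fun m => by
    have := Finset.single_le_sum (f := fun m => ‖e m‖) (fun m _ => norm_nonneg (e m))
      (Finset.mem_univ m)
    linarith
  have hR0 : 0 < R := by positivity
  refine ⟨B * (2 + 2 * R), by positivity, fun L w wreg hlog hL hw hreg t => ?_⟩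
  -- The potential B‖w t‖²/(2R) absorbs the telescoping part of the displacements, so the induction
  -- closes with a bound linear in t. It vanishes at t = 0.
  have key : ∀ t : ℕ, ‖wreg t - L • w t‖ + B * (‖w t‖ ^ 2 / (2 * R)) ≤
      B * (t * (Real.log L + 1 + 2 * R)) := by
    intro t
    induction t with
    | zero => simp [hw.init, hreg.init]
    | succ t ih =>
      have hp := hw.isProjection t
      -- The auxiliary step u starts from L • w t exactly: nonexpansiveness carries the old error
      -- over unamplified, and the one-step estimate bounds the new error.
      obtain ⟨u, hu⟩ := exists_isMinOn_proximalObjective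
        (fun i => signedFeature (S (τ t) i)) (Real.exp_pos (-L)) (L • w t)
      have hs := hreg.step t
      rw [regularizedObjective_eq] at hs
      have h1 := proximal_nonexpansive (Real.exp_pos (-L)) hs hu
      have h2 := hA (τ t) L (w t) (w (t + 1)) u hL hp hu
      have h3 := hp.norm_sub_le_telescoping (fun i => he' (τ t) i) hR0 (heR (τ t))
      have h4 : ‖u - L • w (t + 1)‖ ≤
          B * (Real.log L + 1 + (2 * R + (‖w t‖ ^ 2 - ‖w (t + 1)‖ ^ 2) / (2 * R))) := by
        refine h2.trans (mul_le_mul (hAB _) (by linarith) (by positivity) hB0)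
      have h5 := norm_sub_le_norm_sub_add_norm_sub (wreg (t + 1)) u (L • w (t + 1))
      rw [sub_div] at h4
      push_cast
      linarith
  have h1 := key t
  have h2 : 0 ≤ B * (‖w t‖ ^ 2 / (2 * R)) := by positivity
  have h3 : B * (t * (Real.log L + 1 + 2 * R)) ≤ B * (2 + 2 * R) * (t * Real.log L) := by
    have h4 : Real.log L + 1 + 2 * R ≤ (2 + 2 * R) * Real.log L := by nlinarith
    have h5 := mul_le_mul_of_nonneg_left h4 (mul_nonneg hB0 (Nat.cast_nonneg t))
    linarith
  linarith

/-- Margin at least one on a single sample forces ‖w‖ ≥ 1/‖z‖ by Cauchy-Schwarz; one sample per task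
gives a bound uniform in t. -/
theorem IsMaxMarginRun.exists_le_norm (hN : ∀ m, 0 < N m) (S : Datasets D T N) (τ : ℕ → Fin T) :
    ∃ c : ℝ, 0 < c ∧ ∀ w : ℕ → EuclideanSpace ℝ (Fin D), IsMaxMarginRun S τ w →
      ∀ t, 1 ≤ t → c ≤ ‖w t‖ := by
  set Z := 1 + ∑ m, ‖signedFeature (S m ⟨0, hN m⟩)‖ with hZ
  have hZ0 : 0 < Z := by positivity
  refine ⟨Z⁻¹, inv_pos.2 hZ0, fun w hw t ht => ?_⟩
  obtain ⟨t, rfl⟩ := Nat.exists_eq_add_of_le' ht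
  have h1 := hw.feasible t ⟨0, hN _⟩
  rw [margin_eq_inner] at h1
  have h2 := h1.trans (real_inner_le_norm _ _)
  have h3 := Finset.single_le_sum (f := fun m => ‖signedFeature (S m ⟨0, hN m⟩)‖)
    (fun m _ => norm_nonneg _) (Finset.mem_univ (τ t))
  rw [inv_le_iff_one_le_mul₀ hZ0]
  nlinarith [norm_nonneg (w (t + 1))]

end Runs

/-! ### Asymptotics as the strength tends to zero, and the theorem. -/

theorem tendsto_log_one_div_nhdsGT_zero :
    Tendsto (fun l : ℝ => Real.log (1 / l)) (𝓝[>] 0) atTop := by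
  simp only [one_div]
  exact Real.tendsto_log_atTop.comp tendsto_inv_nhdsGT_zero

theorem tendsto_div_log_atTop : Tendsto (fun x : ℝ => x / Real.log x) atTop atTop := by
  have h1 : Tendsto (fun x : ℝ => Real.log x / x) atTop (𝓝[>] 0) := by
    refine tendsto_nhdsWithin_iff.2 ⟨Real.isLittleO_log_id_atTop.tendsto_div_nhds_zero, ?_⟩
    filter_upwards [eventually_gt_atTop 1] with x hx
    exact div_pos (Real.log_pos hx) (by linarith)
  refine (tendsto_inv_nhdsGT_zero.comp h1).congr fun x => ?_
  simp [inv_div]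

theorem theorem1 (D T : ℕ) (N : Fin T → ℕ) (hN : ∀ m, 0 < N m) (τ : ℕ → Fin T)
    (P : Measure (Datasets D T N)) (hP : P ≪ datasetMeasure D T N) :
    ∀ᵐ S ∂P, (∀ m, Separable (S m)) →
      (∃! w : ℕ → EuclideanSpace ℝ (Fin D), IsMaxMarginRun S τ w) ∧
      (∀ l : ℝ, 0 < l → ∃! w : ℕ → EuclideanSpace ℝ (Fin D), IsRegularizedRun S τ l w) ∧
      ∀ (w : ℕ → EuclideanSpace ℝ (Fin D)) (wreg : ℝ → ℕ → EuclideanSpace ℝ (Fin D)),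
        IsMaxMarginRun S τ w → (∀ l : ℝ, 0 < l → IsRegularizedRun S τ l (wreg l)) →
        (∃ C : ℝ, ∀ᶠ l : ℝ in 𝓝[>] 0, ∀ t : ℕ,
          ‖wreg l t - Real.log (1 / l) • w t‖ ≤ C * ((t : ℝ) * Real.log (Real.log (1 / l)))) ∧
        (∀ t : ℕ, 1 ≤ t → w t ≠ 0) ∧
        (∀ t : ℕ, 1 ≤ t →
          Tendsto (fun l : ℝ => direction (wreg l t)) (𝓝[>] 0) (𝓝 (direction (w t)))) ∧
        (∀ t : ℝ → ℕ, (∀ᶠ l : ℝ in 𝓝[>] 0, 1 ≤ t l) →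
          (fun l : ℝ => (t l : ℝ)) =o[𝓝[>] 0]
            (fun l : ℝ => Real.log (1 / l) / Real.log (Real.log (1 / l))) →
          (∀ᶠ l : ℝ in 𝓝[>] 0, wreg l (t l) ≠ 0) ∧
          Tendsto (fun l : ℝ => direction (wreg l (t l)) - direction (w (t l)))
            (𝓝[>] 0) (𝓝 0)) := by
  refine Eventually.of_forall fun S hS => ⟨existsUnique_isMaxMarginRun hS τ,
    fun l hl => existsUnique_isRegularizedRun S τ hl, fun w wreg hw hreg => ?_⟩
  obtain ⟨C, hC0, hC⟩ := exists_norm_regularized_sub_le hS τ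
  obtain ⟨c, hc0, hc⟩ := IsMaxMarginRun.exists_le_norm hN S τ
  have hlarge : ∀ᶠ l : ℝ in 𝓝[>] 0,
      1 ≤ Real.log (1 / l) ∧ 1 ≤ Real.log (Real.log (1 / l)) :=
    (tendsto_log_one_div_nhdsGT_zero.eventually_ge_atTop 1).and
      ((Real.tendsto_log_atTop.comp tendsto_log_one_div_nhdsGT_zero).eventually_ge_atTop 1)
  have hbound : ∀ᶠ l : ℝ in 𝓝[>] 0, ∀ t : ℕ,
      ‖wreg l t - Real.log (1 / l) • w t‖ ≤ C * ((t : ℝ) * Real.log (Real.log (1 / l))) := by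
    filter_upwards [hlarge, self_mem_nhdsWithin] with l hl hl0
    have h1 : Real.exp (-Real.log (1 / l)) = l := by
      rw [one_div, Real.log_inv, neg_neg, Real.exp_log hl0]
    exact hC _ w (wreg l) hl.2 hl.1 hw (by rw [h1]; exact hreg l hl0)
  have hw0 : ∀ t : ℕ, 1 ≤ t → w t ≠ 0 := fun t ht =>
    norm_pos_iff.1 (hc0.trans_le (hc w hw t ht))
  have hvary : ∀ t : ℝ → ℕ, (∀ᶠ l : ℝ in 𝓝[>] 0, 1 ≤ t l) →
      (fun l : ℝ => (t l : ℝ)) =o[𝓝[>] 0]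
        (fun l : ℝ => Real.log (1 / l) / Real.log (Real.log (1 / l))) →
      (∀ᶠ l : ℝ in 𝓝[>] 0, wreg l (t l) ≠ 0) ∧
      Tendsto (fun l : ℝ => direction (wreg l (t l)) - direction (w (t l)))
        (𝓝[>] 0) (𝓝 0) := by
    intro t ht1 hto
    -- This bounds the error relative to ‖L • w t‖ ≥ c L, and tends to 0 by the growth condition on
    -- t.
    set g : ℝ → ℝ := fun l =>
      C / c * ((t l : ℝ) / (Real.log (1 / l) / Real.log (Real.log (1 / l)))) with hg
    have hg0 : Tendsto g (𝓝[>] 0) (𝓝 0) := by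
      have := hto.tendsto_div_nhds_zero.const_mul (C / c)
      rwa [mul_zero] at this
    have hrel : ∀ᶠ l : ℝ in 𝓝[>] 0, 0 < ‖Real.log (1 / l) • w (t l)‖ ∧
        ‖wreg l (t l) - Real.log (1 / l) • w (t l)‖ / ‖Real.log (1 / l) • w (t l)‖ ≤ g l := by
      filter_upwards [hlarge, hbound, ht1] with l hl hb ht
      have hL : 0 < Real.log (1 / l) := by linarith [hl.1]
      have h1 : c * Real.log (1 / l) ≤ ‖Real.log (1 / l) • w (t l)‖ := by
        rw [norm_smul, Real.norm_of_nonneg hL.le, mul_comm]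
        exact mul_le_mul_of_nonneg_left (hc w hw _ ht) hL.le
      have h2 : 0 < c * Real.log (1 / l) := mul_pos hc0 hL
      refine ⟨h2.trans_le h1, (div_le_div₀ ?_ (hb _) h2 h1).trans_eq ?_⟩
      · have := hl.2
        positivity
      · have := hl.2
        simp only [hg]
        field_simp
    constructor
    -- A zero iterate would have relative error exactly 1.
    · filter_upwards [hrel, hg0.eventually (gt_mem_nhds one_pos)] with l hl hgl h0
      have h1 := hl.2
      rw [h0, zero_sub, norm_neg, div_self hl.1.ne'] at h1
      linarith
    · refine squeeze_zero_norm' ?_ (by simpa using hg0.const_mul 2)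
      filter_upwards [hrel, hlarge] with l hl hl1
      have hL : 0 < Real.log (1 / l) := by linarith [hl1.1]
      have h1 : direction (w (t l)) = direction (Real.log (1 / l) • w (t l)) := by
        simp only [direction]
        rw [norm_smul, Real.norm_of_nonneg hL.le, mul_inv, smul_smul, mul_right_comm,
          inv_mul_cancel₀ hL.ne', one_mul]
      rw [h1]
      refine (norm_inv_smul_sub_inv_smul_le _ (norm_pos_iff.1 hl.1)).trans ?_
      exact mul_le_mul_of_nonneg_left hl.2 two_pos.le
  refine ⟨⟨C, hbound⟩, hw0, fun t ht => ?_, hvary⟩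
  -- A fixed t is the constant case of `hvary`, since L / log L tends to infinity.
  have ho : (fun _ : ℝ => (t : ℝ)) =o[𝓝[>] 0]
      (fun l : ℝ => Real.log (1 / l) / Real.log (Real.log (1 / l))) := by
    refine isLittleO_const_left.2 (Or.inr ?_)
    exact tendsto_norm_atTop_atTop.comp
      (tendsto_div_log_atTop.comp tendsto_log_one_div_nhdsGT_zero)
  have := (hvary (fun _ => t) (Eventually.of_forall fun _ => ht) ho).2
  exact tendsto_sub_nhds_zero_iff.1 this
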